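/- Let $K$ be a field and let $\Gamma=(\Gamma_0,\Gamma_1,\mu,\mathfrak o)$ be a Brauer configuration: $\Gamma_0$ is a finite set of vertices, $\Gamma_1$ a finite set of labelled polygons, each a finite multiset of at least two vertices, $\mu:\Gamma_0\to\mathbb Z_{>0}$ is the multiplicity function, and $\mathfrak o$ chooses for each vertex $\alpha$ a cyclic ordering (the successor sequence at $\alpha$) of the list of polygons containing $\alpha$, a polygon $V$ being listed $\mathrm{occ}(\alpha,V)$ times, where $\mathrm{occ}(\alpha,V)$ is the multiplicity of $\alpha$ in $V$. Put $\mathrm{val}(\alpha)=\sum_{V\in\Gamma_1}\mathrm{occ}(\alpha,V)$. It is required that every vertex lies in some polygon and that every polygon has a vertex $\alpha$ with $\mu(\alpha)\,\mathrm{val}(\alpha)>1$. A vertex $\alpha$ is truncated if $\mu(\alpha)\,\mathrm{val}(\alpha)=1$, and $\mathscr C_\Gamma=\{\alpha\in\Gamma_0 : \mathrm{val}(\alpha)=1,\ \mu(\alpha)>1\}$. The quiver $\mathcal Q$ of $\Gamma$ has one vertex for each polygon and, for each nontruncated $\alpha$ and each position in the successor sequence at $\alpha$, one arrow from the polygon $V$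 at that position to its successor (the polygon at the cyclically next position). For a nontruncated $\alpha$ the $\mathrm{val}(\alpha)$ arrows obtained from $\alpha$ form an oriented cycle; the $\mathrm{val}(\alpha)$ cycles obtained by choosing the starting arrow are the special $\alpha$-cycles. The algebra of $\Gamma$ is $\Lambda=K\mathcal Q/I$, where $I$ is the two-sided ideal of the path algebra generated by (1) $C^{\mu(\alpha)}-D^{\mu(\beta)}$ for special $\alpha$-cycles $C$ and special $\beta$-cycles $D$ starting at the same vertex of $\mathcal Q$; (2) $C^{\mu(\alpha)}a$ for a special $\alpha$-cycle $C$ with first arrow $a$; (3) the paths $ab$ of length two that are not subpaths of a special cycle, except for $aa$ where $a$ is the loop given by a vertex in $\mathscr C_\Gamma$. Suppose that $\Gamma$ is a Brauer tree, that is, every polygon has exactly two vertices (counted with multiplicity) and the graph with vertex set $\Gamma_0$ and edge set $\Gamma_1$ is a tree, and that this graph is not the graph with a single vertex and a single loop. Then the number of loops of $\mathcal Q$ is $\#\mathit{Loops}(\mathcal Q)=|\mathscr C_\Gamma|$, the center $Z(\Lambda)$ of the Brauer tree algebra $\Lambda$ is finite-dimensional, and $$\dim_K Z(\Lambda)=1+\sum_{\alpha\in\Gamma_0}\mu(\alpha)+|\Gamma_1|-|\Gamma_0|.$$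 -/

import Mathlib

/-! ## Path algebras of quivers -/

section PathAlgebra

universe u v w

/-- The set of all paths of a quiver, including the trivial path at every vertex. -/
abbrev QuiverPath (Q : Type u) [Quiver.{v} Q] := Σ a : Q, Σ b : Q, Quiver.Path a b

/-- The path algebra `K Q`: the vector space with the set of all paths of `Q` as a basis.
Paths are composed from left to right: `p * q` is first `p` and then `q`. -/
def PathAlgebra (K : Type w) (Q : Type u) [Quiver.{v} Q] [CommRing K] := QuiverPath Q →₀ K

namespace PathAlgebra

variable {K : Type w} {Q : Type u} [Quiver.{v} Q] [CommRing K]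

noncomputable instance : AddCommGroup (PathAlgebra K Q) :=
  inferInstanceAs (AddCommGroup (QuiverPath Q →₀ K))

noncomputable instance : Module K (PathAlgebra K Q) :=
  inferInstanceAs (Module K (QuiverPath Q →₀ K))

variable (K) in
/-- A path, as an element of the path algebra. -/
noncomputable def ofPath {a b : Q} (p : Quiver.Path a b) : PathAlgebra K Q :=
  (Finsupp.single (⟨a, b, p⟩ : QuiverPath Q) (1 : K) : QuiverPath Q →₀ K)

open Classical in
variable (K) in
/-- The product of two paths: their concatenation if the first ends where the second starts,
and zero otherwise. -/
noncomputable def pathMul (p q : QuiverPath Q) : PathAlgebra K Q :=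
  if h : q.1 = p.2.1 then ofPath K (p.2.2.comp (q.2.2.cast h rfl)) else 0

/-- The bilinear extension of the product of paths. -/
noncomputable def mulHom : PathAlgebra K Q →ₗ[K] PathAlgebra K Q →ₗ[K] PathAlgebra K Q :=
  Finsupp.linearCombination K
    (fun p : QuiverPath Q => Finsupp.linearCombination K (fun q : QuiverPath Q => pathMul K p q))

noncomputable instance : Mul (PathAlgebra K Q) := ⟨fun f g => mulHom f g⟩

/-- The unit of the path algebra is the sum of all trivial paths. -/
noncomputable instance [Fintype Q] : One (PathAlgebra K Q) :=
  ⟨∑ a : Q, ofPath K (Quiver.Path.nil : Quiver.Path a a)⟩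

theorem mul_def (f g : PathAlgebra K Q) : f * g = mulHom f g := rfl

theorem one_def [Fintype Q] :
    (1 : PathAlgebra K Q) = ∑ a : Q, ofPath K (Quiver.Path.nil : Quiver.Path a a) := rfl

theorem mulHom_ofPath {a b c d : Q} (p : Quiver.Path a b) (q : Quiver.Path c d) :
    mulHom (ofPath K p) (ofPath K q) = pathMul K ⟨a, b, p⟩ ⟨c, d, q⟩ := by
  unfold mulHom ofPath
  erw [Finsupp.linearCombination_single, one_smul, Finsupp.linearCombination_single, one_smul]

/-- Composable paths multiply by concatenation. -/
theorem ofPath_mul_ofPath {a b c : Q} (p : Quiver.Path a b) (q : Quiver.Path b c) :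
    ofPath K p * ofPath K q = ofPath K (p.comp q) := by
  rw [mul_def, mulHom_ofPath]
  simp [pathMul]

/-- Paths that cannot be composed have product zero. -/
theorem ofPath_mul_ofPath_of_ne {a b c d : Q} (p : Quiver.Path a b) (q : Quiver.Path c d)
    (h : c ≠ b) : ofPath K p * ofPath K q = 0 := by
  rw [mul_def, mulHom_ofPath]
  simp [pathMul, h]

theorem induction_on {P : PathAlgebra K Q → Prop} (f : PathAlgebra K Q)
    (h0 : P 0) (hadd : ∀ f g, P f → P g → P (f + g))
    (hpath : ∀ (r : K) {a b : Q} (p : Quiver.Path a b), P (r • ofPath K p)) : P f := by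
  refine Finsupp.induction_linear (motive := P) f h0 hadd ?_
  rintro ⟨a, b, p⟩ r
  have h : (Finsupp.single (⟨a, b, p⟩ : QuiverPath Q) r : QuiverPath Q →₀ K)
      = r • (Finsupp.single (⟨a, b, p⟩ : QuiverPath Q) (1 : K) : QuiverPath Q →₀ K) := by
    rw [Finsupp.smul_single, smul_eq_mul, mul_one]
  rw [h]
  exact hpath r p

theorem ofPath_mul_assoc {a b c d e f : Q} (p : Quiver.Path a b) (q : Quiver.Path c d)
    (r : Quiver.Path e f) :
    ofPath K p * ofPath K q * ofPath K r = ofPath K p * (ofPath K q * ofPath K r) := by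
  have zl : ∀ x : PathAlgebra K Q, 0 * x = 0 := fun x => by rw [mul_def, map_zero]; rfl
  have zr : ∀ x : PathAlgebra K Q, x * 0 = 0 := fun x => by rw [mul_def, map_zero]
  by_cases h1 : c = b
  · subst h1
    by_cases h2 : e = d
    · subst h2
      simp only [ofPath_mul_ofPath, Quiver.Path.comp_assoc]
    · rw [ofPath_mul_ofPath, ofPath_mul_ofPath_of_ne _ _ h2, ofPath_mul_ofPath_of_ne _ _ h2, zr]
  · by_cases h2 : e = d
    · subst h2
      rw [ofPath_mul_ofPath, ofPath_mul_ofPath_of_ne _ _ h1, ofPath_mul_ofPath_of_ne _ _ h1, zl]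
    · rw [ofPath_mul_ofPath_of_ne _ _ h1, ofPath_mul_ofPath_of_ne _ _ h2, zl, zr]

theorem one_mul_ofPath [Fintype Q] {a b : Q} (p : Quiver.Path a b) :
    1 * ofPath K p = ofPath K p := by
  rw [one_def, mul_def, map_sum, LinearMap.sum_apply, Finset.sum_eq_single a]
  · rw [← mul_def, ofPath_mul_ofPath, Quiver.Path.nil_comp]
  · intro c _ hc
    rw [← mul_def, ofPath_mul_ofPath_of_ne _ _ hc.symm]
  · intro h
    exact absurd (Finset.mem_univ _) h

theorem ofPath_mul_one [Fintype Q] {a b : Q} (p : Quiver.Path a b) :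
    ofPath K p * 1 = ofPath K p := by
  rw [one_def, mul_def, map_sum, Finset.sum_eq_single b]
  · rw [← mul_def, ofPath_mul_ofPath, Quiver.Path.comp_nil]
  · intro c _ hc
    rw [← mul_def, ofPath_mul_ofPath_of_ne _ _ hc]
  · intro h
    exact absurd (Finset.mem_univ _) h

noncomputable instance [Fintype Q] : Ring (PathAlgebra K Q) :=
  { (inferInstance : AddCommGroup (PathAlgebra K Q)),
    (inferInstance : Mul (PathAlgebra K Q)),
    (inferInstance : One (PathAlgebra K Q)) with
    left_distrib := fun f g h => map_add (mulHom f) g h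
    right_distrib := fun f g h => by
      change mulHom (f + g) h = mulHom f h + mulHom g h
      rw [map_add, LinearMap.add_apply]
    zero_mul := fun f => by
      change mulHom 0 f = 0
      rw [map_zero, LinearMap.zero_apply]
    mul_zero := fun f => map_zero (mulHom f)
    mul_assoc := fun f g h => by
      change mulHom (mulHom f g) h = mulHom f (mulHom g h)
      induction f using induction_on with
      | h0 => simp
      | hadd f f' hf hf' => simp only [map_add, LinearMap.add_apply, hf, hf']
      | hpath r p =>
        induction g using induction_on with
        | h0 => simp
        | hadd g g' hg hg' => simp only [map_add, LinearMap.add_apply, hg, hg']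
        | hpath s q =>
          induction h using induction_on with
          | h0 => simp
          | hadd h h' hh hh' => simp only [map_add, hh, hh']
          | hpath t x =>
            have := ofPath_mul_assoc (K := K) p q x
            simp only [mul_def] at this
            simp only [map_smul, LinearMap.smul_apply, this]
    one_mul := fun f => by
      change mulHom 1 f = f
      induction f using induction_on with
      | h0 => simp
      | hadd f g hf hg => rw [map_add, hf, hg]
      | hpath r p => rw [map_smul, ← mul_def, one_mul_ofPath]
    mul_one := fun f => by
      change mulHom f 1 = f
      induction f using induction_on with
      | h0 => simp
      | hadd f g hf hg => rw [map_add, LinearMap.add_apply, hf, hg]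
      | hpath r p => rw [map_smul, LinearMap.smul_apply, ← mul_def, ofPath_mul_one] }

noncomputable instance [Fintype Q] : Algebra K (PathAlgebra K Q) :=
  Algebra.ofModule
    (fun r f g => by
      change mulHom (r • f) g = r • mulHom f g
      rw [map_smul, LinearMap.smul_apply])
    (fun r f g => by
      change mulHom f (r • g) = r • mulHom f g
      rw [map_smul])

end PathAlgebra

end PathAlgebra

/-! ## Brauer configurations -/

/-- A tuple `(Γ₀, Γ₁, μ)`: finite sets `Γ₀` of vertices and `Γ₁` of (labels of) polygons,
for each polygon its finite multiset of vertices, and a multiplicity function. -/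
structure BrauerData (Γ₀ Γ₁ : Type*) where
  /-- The multiset of vertices of a polygon. -/
  polygon : Γ₁ → Multiset Γ₀
  /-- The multiplicity function. -/
  μ : Γ₀ → ℕ
  μ_pos : ∀ α, 0 < μ α

namespace BrauerData

variable {Γ₀ Γ₁ : Type*} [DecidableEq Γ₀] [Fintype Γ₁]

/-- The number of times `α` occurs as a vertex of the polygon `V`. -/
def occ (D : BrauerData Γ₀ Γ₁) (α : Γ₀) (V : Γ₁) : ℕ := (D.polygon V).count α

/-- The valency of a vertex. -/
def val (D : BrauerData Γ₀ Γ₁) (α : Γ₀) : ℕ := ∑ V : Γ₁, D.occ α V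

end BrauerData

/-- A Brauer configuration `(Γ₀, Γ₁, μ, 𝔬)`. The orientation is given, for each vertex `α`, by a
list `seq α 0 < seq α 1 < ⋯ < seq α (val α - 1)` of the polygons in which `α` occurs, each polygon
`V` being listed `occ α V` times. The list represents a cyclic ordering: indices are
understood modulo `val α`. -/
structure BrauerConfiguration (Γ₀ Γ₁ : Type*) [DecidableEq Γ₀] [Fintype Γ₁]
    extends BrauerData Γ₀ Γ₁ where
  /-- The successor sequences. -/
  seq : ∀ α : Γ₀, Fin (toBrauerData.val α) → Γ₁
  seq_count : ∀ (α : Γ₀) (V : Γ₁), Nat.card {i // seq α i = V} = toBrauerData.occ α V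
  exists_polygon : ∀ α : Γ₀, ∃ V : Γ₁, α ∈ polygon V
  two_le_card : ∀ V : Γ₁, 2 ≤ (polygon V).card
  exists_nontruncated : ∀ V : Γ₁, ∃ α ∈ polygon V, 1 < toBrauerData.val α * μ α

namespace BrauerConfiguration

variable {Γ₀ Γ₁ : Type*} [DecidableEq Γ₀] [Fintype Γ₁]

/-- Truncated vertices. -/
def Truncated (Γ : BrauerConfiguration Γ₀ Γ₁) (α : Γ₀) : Prop := Γ.μ α * Γ.val α = 1

/-- The set `𝒞_Γ` of vertices with valency one and multiplicity greater than one. -/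
def setC (Γ : BrauerConfiguration Γ₀ Γ₁) : Set Γ₀ := {α | Γ.val α = 1 ∧ 1 < Γ.μ α}

/-! ### The quiver -/

/-- The arrows of the quiver of `Γ`: for every nontruncated vertex `α`, one arrow for each
position in the successor sequence at `α`. -/
abbrev Arrow (Γ : BrauerConfiguration Γ₀ Γ₁) := Σ α : {α : Γ₀ // ¬ Γ.Truncated α}, Fin (Γ.val α.1)

/-- The arrow `⟨α, i⟩` starts at the polygon in position `i` of the successor sequence at `α`. -/
def source (Γ : BrauerConfiguration Γ₀ Γ₁) (a : Γ.Arrow) : Γ₁ := Γ.seq a.1.1 a.2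

/-- The next arrow in the cyclic order at the same vertex of `Γ`. -/
def next (Γ : BrauerConfiguration Γ₀ Γ₁) (a : Γ.Arrow) : Γ.Arrow :=
  ⟨a.1, finRotate (Γ.val a.1.1) a.2⟩

/-- The arrow `⟨α, i⟩` ends at the successor at `α` of the polygon at which it starts. -/
def target (Γ : BrauerConfiguration Γ₀ Γ₁) (a : Γ.Arrow) : Γ₁ := Γ.source (Γ.next a)

/-- The vertices of the quiver of `Γ`: there is one for each polygon. -/
def QVertex (_Γ : BrauerConfiguration Γ₀ Γ₁) : Type _ := Γ₁

instance (Γ : BrauerConfiguration Γ₀ Γ₁) : Fintype Γ.QVertex := inferInstanceAs (Fintype Γ₁)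

/-- The quiver of `Γ`. -/
instance (Γ : BrauerConfiguration Γ₀ Γ₁) : Quiver Γ.QVertex where
  Hom V W := {a : Γ.Arrow // Γ.source a = V ∧ Γ.target a = W}

/-- The number of loops of the quiver of `Γ`. -/
noncomputable def numLoops (Γ : BrauerConfiguration Γ₀ Γ₁) : ℕ :=
  Nat.card (Σ V : Γ.QVertex, (V ⟶ V))

/-- An arrow as an arrow of the quiver, between its end points. -/
def Arrow.hom {Γ : BrauerConfiguration Γ₀ Γ₁} (a : Γ.Arrow) :
    (show Γ.QVertex from Γ.source a) ⟶ (show Γ.QVertex from Γ.target a) :=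
  ⟨a, rfl, rfl⟩

/-- The special cycle that starts with the arrow `a = ⟨α, i⟩`, as the list of its `val α` arrows.
It is a special `α`-cycle at the source of `a`. -/
def specialCycle (Γ : BrauerConfiguration Γ₀ Γ₁) (a : Γ.Arrow) : List Γ.Arrow :=
  List.iterate Γ.next a (Γ.val a.1.1)

/-! ### The algebra -/

section Algebra

variable (K : Type*) [CommRing K] (Γ : BrauerConfiguration Γ₀ Γ₁)

/-- An arrow as an element of the path algebra. -/
noncomputable def arrowElt (a : Γ.Arrow) : PathAlgebra K Γ.QVertex :=
  PathAlgebra.ofPath K a.hom.toPath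

/-- The special cycle that starts with the arrow `a`, as an element of the path algebra. -/
noncomputable def cycleElt (a : Γ.Arrow) : PathAlgebra K Γ.QVertex :=
  ((Γ.specialCycle a).map (Γ.arrowElt K)).prod

/-- Relations of type one: `C ^ μ(α) - D ^ μ(β)` for special cycles `C`, `D` at the same vertex of
the quiver, where `C` is a special `α`-cycle and `D` is a special `β`-cycle. -/
def relationsOne : Set (PathAlgebra K Γ.QVertex) :=
  {x | ∃ a b : Γ.Arrow, Γ.source a = Γ.source b ∧
    x = Γ.cycleElt K a ^ Γ.μ a.1.1 - Γ.cycleElt K b ^ Γ.μ b.1.1}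

/-- Relations of type two: `C ^ μ(α)` followed by the first arrow of `C`, for a special
`α`-cycle `C`. -/
def relationsTwo : Set (PathAlgebra K Γ.QVertex) :=
  {x | ∃ a : Γ.Arrow, x = Γ.cycleElt K a ^ Γ.μ a.1.1 * Γ.arrowElt K a}

/-- Relations of type three: the paths `a b` of length two that are not subpaths of a special
cycle, except `a a` where `a` is the loop of a vertex of valency one. -/
def relationsThree : Set (PathAlgebra K Γ.QVertex) :=
  {x | ∃ a b : Γ.Arrow, Γ.target a = Γ.source b ∧ (¬ ∃ c : Γ.Arrow, [a, b] <:+: Γ.specialCycle c) ∧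
    ¬ (a = b ∧ Γ.val a.1.1 = 1) ∧ x = Γ.arrowElt K a * Γ.arrowElt K b}

/-- The two-sided ideal of relations. -/
noncomputable def relationIdeal : TwoSidedIdeal (PathAlgebra K Γ.QVertex) :=
  TwoSidedIdeal.span (Γ.relationsOne K ∪ Γ.relationsTwo K ∪ Γ.relationsThree K)

/-- The Brauer configuration algebra: the path algebra modulo the ideal of relations. -/
abbrev brauerAlgebra : Type _ := (Γ.relationIdeal K).ringCon.Quotient

end Algebra

/-! ### Brauer graphs and Brauer trees -/

/-- A Brauer graph: every polygon is a 2-gon, that is, an edge. -/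
def IsBrauerGraph (Γ : BrauerConfiguration Γ₀ Γ₁) : Prop := ∀ V, (Γ.polygon V).card = 2

/-- The simple graph of adjacency in the graph `(Γ₀, Γ₁)`. -/
def adjGraph (Γ : BrauerConfiguration Γ₀ Γ₁) : SimpleGraph Γ₀ where
  Adj α β := α ≠ β ∧ ∃ V, Γ.polygon V = {α, β}
  symm := ⟨fun _ _ ⟨h, V, hV⟩ => ⟨h.symm, V, by rw [hV, Multiset.pair_comm]⟩⟩
  loopless := ⟨fun _ h => h.1 rfl⟩

/-- A Brauer tree: a Brauer graph such that the graph `(Γ₀, Γ₁)` is a tree, that is, it has no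
loops, no two parallel edges, and its adjacency graph is connected and without cycles. -/
structure IsBrauerTree (Γ : BrauerConfiguration Γ₀ Γ₁) : Prop where
  isBrauerGraph : Γ.IsBrauerGraph
  no_loops : ∀ V, (Γ.polygon V).Nodup
  no_parallel : Function.Injective Γ.polygon
  isTree : Γ.adjGraph.IsTree

/-- The graph `(Γ₀, Γ₁)` has one vertex and one edge, which is a loop. -/
def IsSingleLoop (Γ : BrauerConfiguration Γ₀ Γ₁) : Prop :=
  ∃ (α : Γ₀) (V : Γ₁), (∀ β, β = α) ∧ (∀ W, W = V) ∧ Γ.polygon V = {α, α}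

end BrauerConfiguration

/-! The algebra is symmetric, and its center is computed by pairing it with a few elements. The
linear form on paths that is one on each `C ^ μ(α)` and zero on every other path kills all
relations, so it descends to `form`, which satisfies `form (x * y) = form (y * x)`
(`form_mul_comm`). The algebra is spanned by its runs: paths of length at most `fullLength` that
follow one special cycle. Pairing each run with its complement in the full cycle recovers every
element from its values under the form (`eq_sum_form_smul`). Thus `x` is zero once `form (x * r) =
0` for all runs `r`, and no normal form for paths is needed.

For central `z`, the functional `y ↦ form (z * y)` vanishes on commutators. It is therefore zero on
runs that do not close up, unchanged when a proper power of a special cycle is rotated, and constant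
on full cycles along the connected quiver. In a tree no polygon contains a vertex twice, so the only
closed runs are idempotents and powers of special cycles. Hence `z` is determined by one value on a
full cycle, one for each power `0 < j < μ(α)` at each nontruncated `α`, and one for each polygon
(`central_eq_zero`). Conversely the unit, the rotation sums of these powers and the socle elements
are central and dual to these test elements (`form_centerBasis_mul_centerDual`). The dimension is
the number of indices, since a truncated vertex contributes `μ(α) - 1 = 0`.

A loop joins an arrow to the next one at the same vertex; in a tree the two arrows then coincide,
which forces valency one. -/

namespace BrauerConfiguration

variable {Γ₀ Γ₁ : Type*} [DecidableEq Γ₀] [Fintype Γ₁]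

/-! ### Rotation of arrows along special cycles -/

section Arrows

variable {Γ : BrauerConfiguration Γ₀ Γ₁}

/-- The length of the cycle power `C ^ μ(α)` for a special cycle `C` starting with the arrow. -/
def Arrow.fullLength (a : Γ.Arrow) : ℕ := Γ.val a.1.1 * Γ.μ a.1.1

theorem Arrow.val_pos (a : Γ.Arrow) : 0 < Γ.val a.1.1 := a.2.pos

theorem Arrow.two_le_fullLength (a : Γ.Arrow) : 2 ≤ a.fullLength := by
  have h1 : a.fullLength ≠ 1 := fun h => a.1.2 (by rw [Truncated, mul_comm]; exact h)
  have h2 : 0 < a.fullLength := Nat.mul_pos a.val_pos (Γ.μ_pos _)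
  omega

@[simp] theorem next_fst (a : Γ.Arrow) : (Γ.next a).1 = a.1 := rfl

@[simp] theorem next_iterate_fst (a : Γ.Arrow) (k : ℕ) : (Γ.next^[k] a).1 = a.1 := by
  induction k with
  | zero => rfl
  | succ k ih => rw [Function.iterate_succ_apply', next_fst, ih]

theorem fullLength_congr {a b : Γ.Arrow} (h : a.1 = b.1) : a.fullLength = b.fullLength := by
  rw [Arrow.fullLength, Arrow.fullLength, h]

@[simp] theorem fullLength_next (a : Γ.Arrow) : (Γ.next a).fullLength = a.fullLength := rfl

@[simp] theorem fullLength_next_iterate (a : Γ.Arrow) (k : ℕ) :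
    (Γ.next^[k] a).fullLength = a.fullLength := fullLength_congr (next_iterate_fst a k)

theorem finRotate_val_eq_mod {n : ℕ} (i : Fin n) : (finRotate n i : ℕ) = (i + 1) % n := by
  obtain ⟨m, rfl⟩ : ∃ m, n = m + 1 := ⟨n - 1, by have := i.pos; omega⟩
  rw [finRotate_apply, Fin.val_add, Fin.val_one', Nat.add_mod_mod]

theorem next_iterate_eq (α : {α : Γ₀ // ¬ Γ.Truncated α}) (i : Fin (Γ.val α.1)) (k : ℕ) :
    Γ.next^[k] (⟨α, i⟩ : Γ.Arrow) = ⟨α, ⟨(i + k) % Γ.val α.1, Nat.mod_lt _ i.pos⟩⟩ := by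
  induction k with
  | zero => simp [Nat.mod_eq_of_lt i.2]
  | succ k ih =>
    rw [Function.iterate_succ_apply', ih]
    refine Sigma.ext rfl (heq_of_eq (Fin.ext ?_))
    change (finRotate (Γ.val α.1) _ : Fin _).1 = _
    rw [finRotate_val_eq_mod]
    simp [Nat.add_assoc]

theorem next_iterate_eq_self_iff (a : Γ.Arrow) (k : ℕ) :
    Γ.next^[k] a = a ↔ Γ.val a.1.1 ∣ k := by
  obtain ⟨α, i⟩ := a
  rw [next_iterate_eq]
  constructor
  · intro h
    have h2 : (i + k) % Γ.val α.1 = i := congrArg Fin.val (eq_of_heq (Sigma.mk.inj h).2)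
    have h3 : i + k ≡ i + 0 [MOD Γ.val α.1] := by
      rw [Nat.ModEq, h2, add_zero, Nat.mod_eq_of_lt i.2]
    exact (Nat.modEq_zero_iff_dvd).1 (Nat.ModEq.add_left_cancel' _ h3)
  · rintro ⟨c, rfl⟩
    refine Sigma.ext rfl (heq_of_eq (Fin.ext ?_))
    change (i + Γ.val α.1 * c) % Γ.val α.1 = i
    rw [Nat.add_mul_mod_self_left, Nat.mod_eq_of_lt i.2]

theorem next_iterate_fullLength (a : Γ.Arrow) : Γ.next^[a.fullLength] a = a :=
  (next_iterate_eq_self_iff a _).2 (Dvd.intro _ rfl)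

theorem exists_next_iterate {a b : Γ.Arrow} (h : a.1 = b.1) : ∃ k, Γ.next^[k] a = b := by
  obtain ⟨α, i⟩ := a
  obtain ⟨β, j⟩ := b
  obtain rfl : α = β := h
  refine ⟨Γ.val α.1 - i + j, ?_⟩
  rw [next_iterate_eq]
  refine Sigma.ext rfl (heq_of_eq (Fin.ext ?_))
  change (i + (Γ.val α.1 - i + j)) % Γ.val α.1 = j
  have := i.2
  rw [show (i : ℕ) + (Γ.val α.1 - i + j) = j + Γ.val α.1 by omega, Nat.add_mod_right,
    Nat.mod_eq_of_lt j.2]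

/-- The vertex of the quiver at which an arrow starts. -/
def Arrow.start (a : Γ.Arrow) : Γ.QVertex := Γ.source a

/-- An arrow, as an arrow of the quiver. -/
def Arrow.qhom (a : Γ.Arrow) : a.start ⟶ (Γ.next a).start := a.hom

theorem hom_cases {P : ∀ V W : Γ.QVertex, (V ⟶ W) → Prop} (h : ∀ a : Γ.Arrow, P _ _ a.qhom)
    {V W : Γ.QVertex} (f : V ⟶ W) : P V W f := by
  obtain ⟨a, rfl, rfl⟩ := f
  exact h a

theorem start_next_iterate_fullLength (a : Γ.Arrow) :
    (Γ.next^[a.fullLength] a).start = a.start := by rw [next_iterate_fullLength]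

/-- A list of arrows is full if it is the list of arrows of some `C ^ μ(α)`. -/
def IsFull (l : List Γ.Arrow) : Prop := ∃ a : Γ.Arrow, l = List.iterate Γ.next a a.fullLength

theorem isFull_iterate_iff (a : Γ.Arrow) (k : ℕ) :
    IsFull (List.iterate Γ.next a k) ↔ k = a.fullLength := by
  constructor
  · rintro ⟨b, hb⟩
    have hl : k = b.fullLength := by simpa using congrArg List.length hb
    have hb2 := b.two_le_fullLength
    obtain ⟨m, hm⟩ : ∃ m, k = m + 1 := ⟨k - 1, by omega⟩
    rw [← hl, hm, List.iterate, List.iterate] at hb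
    rw [hl, (List.cons.inj hb).1]
  · rintro rfl
    exact ⟨a, rfl⟩

/-- Two full lists sharing an arrow belong to the same vertex and so have the same length; neither
can properly contain the other. -/
theorem not_isFull_append {l₁ l₂ : List Γ.Arrow} (a : Γ.Arrow) (h : l₁ ≠ [] ∨ l₂ ≠ []) :
    ¬ IsFull (l₁ ++ List.iterate Γ.next a a.fullLength ++ l₂) := by
  rintro ⟨b, hb⟩
  have ha2 := a.two_le_fullLength
  have hmem : a ∈ List.iterate Γ.next b b.fullLength := by
    rw [← hb]
    have : a ∈ List.iterate Γ.next a a.fullLength := List.mem_iterate.2 ⟨0, by omega, rfl⟩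
    simp [this]
  obtain ⟨m, -, hm⟩ := List.mem_iterate.1 hmem
  have hab : a.fullLength = b.fullLength := by rw [hm, fullLength_next_iterate]
  have hl := congrArg List.length hb
  simp only [List.length_append, List.length_iterate] at hl
  rcases h with h | h <;> have := List.length_pos_iff.2 h <;> omega

theorem eq_next_of_infix_iterate {a b c : Γ.Arrow} {n : ℕ}
    (h : [a, b] <:+: List.iterate Γ.next c n) : b = Γ.next a := by
  obtain ⟨s, t, h⟩ := h
  have hl := congrArg List.length h
  simp only [List.length_append, List.length_iterate, List.length_cons, List.length_nil] at hl
  have h1 := List.getElem?_iterate Γ.next c n s.length (by omega)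
  have h2 := List.getElem?_iterate Γ.next c n (s.length + 1) (by omega)
  rw [← h] at h1 h2
  simp only [List.append_assoc, List.getElem?_append_right (Nat.le_refl _),
    List.getElem?_append_right (Nat.le_succ _)] at h1 h2
  simp at h1 h2
  rw [h1, h2, ← Function.iterate_succ_apply, ← Function.iterate_succ_apply' Γ.next]

theorem not_isFull_of_ne_next {a b : Γ.Arrow} (h : b ≠ Γ.next a) (l₁ l₂ : List Γ.Arrow) :
    ¬ IsFull (l₁ ++ [a, b] ++ l₂) := by
  rintro ⟨c, hc⟩
  exact h (eq_next_of_infix_iterate (c := c) ⟨l₁, l₂, hc⟩)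

/-- The monomial relations concern exactly the products of arrows that are not consecutive. -/
theorem ne_next_iff {a b : Γ.Arrow} :
    b ≠ Γ.next a ↔ (¬ ∃ c : Γ.Arrow, [a, b] <:+: Γ.specialCycle c) ∧
      ¬ (a = b ∧ Γ.val a.1.1 = 1) := by
  constructor
  · intro h
    refine ⟨fun ⟨c, hc⟩ => h (eq_next_of_infix_iterate hc), fun ⟨hab, hv⟩ => h ?_⟩
    rw [← hab]
    exact ((next_iterate_eq_self_iff a 1).2 (by rw [hv])).symm
  · rintro ⟨h1, h2⟩ rfl
    have hpos := a.val_pos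
    -- At valency one the special cycle has a single arrow, so `a a` is consecutive without being a
    -- subpath; this is exactly the exception in the type three relations.
    by_cases hv : Γ.val a.1.1 = 1
    · exact h2 ⟨((next_iterate_eq_self_iff a 1).2 (by rw [hv])).symm, hv⟩
    · obtain ⟨m, hm⟩ : ∃ m, Γ.val a.1.1 = m + 1 + 1 := ⟨Γ.val a.1.1 - 2, by omega⟩
      refine h1 ⟨a, [], List.iterate Γ.next (Γ.next (Γ.next a)) m, ?_⟩
      rw [specialCycle, hm]
      rfl

end Arrows

/-! ### The linear form on the path algebra and its vanishing on the relations -/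

section Words

variable (K : Type*) [CommRing K] {Γ : BrauerConfiguration Γ₀ Γ₁}

/-- The list of arrows of a path. -/
def pathArrows : ∀ {V W : Γ.QVertex}, Quiver.Path V W → List Γ.Arrow
  | _, _, .nil => []
  | _, _, .cons p f => pathArrows p ++ [f.1]

theorem pathArrows_nil (V : Γ.QVertex) :
    pathArrows (Quiver.Path.nil : Quiver.Path V V) = [] := by rw [pathArrows]

theorem pathArrows_cons {V W X : Γ.QVertex} (p : Quiver.Path V W) (f : W ⟶ X) :
    pathArrows (p.cons f) = pathArrows p ++ [f.1] := by rw [pathArrows]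

theorem pathArrows_comp {V W X : Γ.QVertex} (p : Quiver.Path V W) (q : Quiver.Path W X) :
    pathArrows (p.comp q) = pathArrows p ++ pathArrows q := by
  induction q with
  | nil => simp [pathArrows]
  | cons q f ih => simp [pathArrows, ih]

/-- The trivial path at `V`. -/
noncomputable def vertexElt (Γ : BrauerConfiguration Γ₀ Γ₁) (V : Γ.QVertex) :
    PathAlgebra K Γ.QVertex :=
  PathAlgebra.ofPath K (Quiver.Path.nil : Quiver.Path V V)

/-- The product of a list of arrows. -/
noncomputable def word (l : List Γ.Arrow) : PathAlgebra K Γ.QVertex :=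
  (l.map (Γ.arrowElt K)).prod

theorem word_append (l₁ l₂ : List Γ.Arrow) : word K (l₁ ++ l₂) = word K l₁ * word K l₂ := by
  simp [word]

@[simp] theorem word_nil : word K ([] : List Γ.Arrow) = 1 := rfl

@[simp] theorem word_singleton (a : Γ.Arrow) : word K [a] = Γ.arrowElt K a := by simp [word]

theorem arrowElt_eq_ofPath (a : Γ.Arrow) :
    Γ.arrowElt K a = PathAlgebra.ofPath K a.qhom.toPath := rfl

theorem vertexElt_mul_arrowElt (V : Γ.QVertex) (a : Γ.Arrow) [Decidable (a.start = V)] :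
    Γ.vertexElt K V * Γ.arrowElt K a = if a.start = V then Γ.arrowElt K a else 0 := by
  rw [arrowElt_eq_ofPath, vertexElt]
  split_ifs with h
  · subst h
    rw [PathAlgebra.ofPath_mul_ofPath, Quiver.Path.nil_comp]
  · exact PathAlgebra.ofPath_mul_ofPath_of_ne _ _ h

theorem arrowElt_mul_vertexElt (V : Γ.QVertex) (a : Γ.Arrow) [Decidable ((Γ.next a).start = V)] :
    Γ.arrowElt K a * Γ.vertexElt K V = if (Γ.next a).start = V then Γ.arrowElt K a else 0 := by
  rw [arrowElt_eq_ofPath, vertexElt]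
  split_ifs with h
  · subst h
    rw [PathAlgebra.ofPath_mul_ofPath, Quiver.Path.comp_nil]
  · exact PathAlgebra.ofPath_mul_ofPath_of_ne _ _ (Ne.symm h)

theorem arrowElt_mul_arrowElt_of_ne {a b : Γ.Arrow} (h : (Γ.next a).start ≠ b.start) :
    Γ.arrowElt K a * Γ.arrowElt K b = 0 :=
  PathAlgebra.ofPath_mul_ofPath_of_ne _ _ h.symm

theorem vertexElt_mul_vertexElt (V W : Γ.QVertex) [Decidable (V = W)] :
    Γ.vertexElt K V * Γ.vertexElt K W = if V = W then Γ.vertexElt K V else 0 := by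
  split_ifs with h
  · subst h
    exact PathAlgebra.ofPath_mul_ofPath _ _
  · exact PathAlgebra.ofPath_mul_ofPath_of_ne _ _ (Ne.symm h)

theorem ofPath_cons {V W X : Γ.QVertex} (p : Quiver.Path V W) (f : W ⟶ X) :
    PathAlgebra.ofPath K (p.cons f) = PathAlgebra.ofPath K p * Γ.arrowElt K f.1 := by
  induction f using hom_cases with
  | h a => exact (PathAlgebra.ofPath_mul_ofPath p a.qhom.toPath).symm

/-- The empty word is excluded because it is the unit, a sum of trivial paths rather than a single
path. -/
theorem word_eq_zero_or (l : List Γ.Arrow) (hl : l ≠ []) : word K l = 0 ∨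
    ∃ (V W : Γ.QVertex) (p : Quiver.Path V W), word K l = PathAlgebra.ofPath K p ∧
      pathArrows p = l := by
  induction l using List.reverseRecOn with
  | nil => exact absurd rfl hl
  | append_singleton l a ih =>
    rw [word_append, word_singleton]
    rcases eq_or_ne l [] with rfl | hl'
    · refine Or.inr ⟨_, _, a.qhom.toPath, by rw [word_nil, one_mul]; rfl, ?_⟩
      rw [Quiver.Hom.toPath, pathArrows_cons, pathArrows_nil]
      rfl
    · rcases ih hl' with h | ⟨V, W, p, h, hp⟩
      · exact Or.inl (by rw [h, zero_mul])
      · by_cases hW : a.start = W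
        · subst hW
          exact Or.inr ⟨_, _, p.cons a.qhom, by rw [h, ofPath_cons]; rfl, by
            rw [pathArrows_cons, hp]; rfl⟩
        · refine Or.inl ?_
          rw [h]
          exact PathAlgebra.ofPath_mul_ofPath_of_ne _ _ hW

theorem exists_path_iterate (a : Γ.Arrow) (k : ℕ) :
    ∃ p : Quiver.Path a.start (Γ.next^[k] a).start,
      pathArrows p = List.iterate Γ.next a k ∧
      PathAlgebra.ofPath K p = Γ.vertexElt K a.start * word K (List.iterate Γ.next a k) := by
  induction k with
  | zero => exact ⟨Quiver.Path.nil, pathArrows_nil _,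
      by rw [List.iterate, word_nil, mul_one]; rfl⟩
  | succ k ih =>
    obtain ⟨p, hp, hw⟩ := ih
    rw [Function.iterate_succ_apply']
    refine ⟨p.cons (Γ.next^[k] a).qhom, ?_, ?_⟩
    · rw [pathArrows_cons, hp, List.iterate_add]
      rfl
    · rw [ofPath_cons, hw, List.iterate_add, word_append, mul_assoc]
      congr 2
      exact (word_singleton K _).symm

theorem vertexElt_mul_word_iterate (a : Γ.Arrow) (k : ℕ) :
    Γ.vertexElt K a.start * word K (List.iterate Γ.next a (k + 1)) =
      word K (List.iterate Γ.next a (k + 1)) := by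
  classical
  rw [List.iterate, word, List.map_cons, List.prod_cons, ← mul_assoc, vertexElt_mul_arrowElt,
    if_pos rfl]

theorem word_iterate_mul_vertexElt (a : Γ.Arrow) (k : ℕ) (V : Γ.QVertex)
    [Decidable ((Γ.next^[k + 1] a).start = V)] :
    word K (List.iterate Γ.next a (k + 1)) * Γ.vertexElt K V =
      if (Γ.next^[k + 1] a).start = V then word K (List.iterate Γ.next a (k + 1)) else 0 := by
  classical
  have h := arrowElt_mul_vertexElt K V (Γ.next^[k] a)
  simp only [← Function.iterate_succ_apply' Γ.next] at h
  rw [List.iterate_add, word_append, mul_assoc]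
  simp only [List.iterate, word_singleton]
  rw [h, mul_ite, mul_zero]

theorem cycleElt_pow (a : Γ.Arrow) (n : ℕ) :
    Γ.cycleElt K a ^ n = word K (List.iterate Γ.next a (Γ.val a.1.1 * n)) := by
  induction n with
  | zero => simp [List.iterate]
  | succ n ih =>
    rw [pow_succ, ih, Nat.mul_succ, List.iterate_add, word_append,
      (next_iterate_eq_self_iff a _).2 (Dvd.intro _ rfl)]
    rfl

open Classical in
/-- The linear form on the path algebra that is one on the paths `C ^ μ(α)` and zero on all other
paths. -/
noncomputable def pathForm (Γ : BrauerConfiguration Γ₀ Γ₁) : PathAlgebra K Γ.QVertex →ₗ[K] K :=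
  Finsupp.linearCombination K
    (fun p : QuiverPath Γ.QVertex => if IsFull (pathArrows p.2.2) then (1 : K) else 0)

open Classical in
theorem pathForm_ofPath {V W : Γ.QVertex} (p : Quiver.Path V W) :
    Γ.pathForm K (PathAlgebra.ofPath K p) = if IsFull (pathArrows p) then 1 else 0 := by
  unfold pathForm PathAlgebra.ofPath
  erw [Finsupp.linearCombination_single, one_smul]

open Classical in
theorem pathForm_vertexElt_mul_word (a : Γ.Arrow) (k : ℕ) :
    Γ.pathForm K (Γ.vertexElt K a.start * word K (List.iterate Γ.next a k)) =
      if k = a.fullLength then 1 else 0 := by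
  obtain ⟨p, hp, hw⟩ := exists_path_iterate K a k
  rw [← hw, pathForm_ofPath, hp]
  simp only [isFull_iterate_iff]

theorem pathForm_mul_word_mul {V W X Y : Γ.QVertex} (p : Quiver.Path V W) (q : Quiver.Path X Y)
    {l : List Γ.Arrow} (hl : l ≠ []) (h : ¬ IsFull (pathArrows p ++ l ++ pathArrows q)) :
    Γ.pathForm K (PathAlgebra.ofPath K p * word K l * PathAlgebra.ofPath K q) = 0 := by
  rcases word_eq_zero_or K l hl with h0 | ⟨V', W', r, hr, rfl⟩
  · rw [h0, mul_zero, zero_mul, map_zero]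
  · rw [hr]
    by_cases h1 : V' = W
    · subst h1
      by_cases h2 : X = W'
      · subst h2
        rw [PathAlgebra.ofPath_mul_ofPath, PathAlgebra.ofPath_mul_ofPath, pathForm_ofPath,
          pathArrows_comp, pathArrows_comp, if_neg h]
      · rw [PathAlgebra.ofPath_mul_ofPath, PathAlgebra.ofPath_mul_ofPath_of_ne _ _ h2, map_zero]
    · rw [PathAlgebra.ofPath_mul_ofPath_of_ne _ _ h1, zero_mul, map_zero]

/-- The two-sided ideal of the elements `x` with `pathForm (u * x * v) = 0` for all `u`, `v`. -/
noncomputable def formKernel (Γ : BrauerConfiguration Γ₀ Γ₁) :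
    TwoSidedIdeal (PathAlgebra K Γ.QVertex) :=
  TwoSidedIdeal.mk' {x | ∀ u v, Γ.pathForm K (u * x * v) = 0}
    (fun u v => by rw [mul_zero, zero_mul, map_zero])
    (fun {x y} hx hy u v => by rw [mul_add, add_mul, map_add, hx, hy, add_zero])
    (fun {x} hx u v => by rw [mul_neg, neg_mul, map_neg, hx, neg_zero])
    (fun {x y} hy u v => by rw [← mul_assoc, hy])
    (fun {x y} hx u v => by rw [← mul_assoc u, mul_assoc, hx])

theorem mem_formKernel {x : PathAlgebra K Γ.QVertex}
    (h : ∀ {V W X Y : Γ.QVertex} (p : Quiver.Path V W) (q : Quiver.Path X Y),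
      Γ.pathForm K (PathAlgebra.ofPath K p * x * PathAlgebra.ofPath K q) = 0) :
    x ∈ Γ.formKernel K := by
  rw [formKernel, TwoSidedIdeal.mem_mk']
  intro u v
  induction u using PathAlgebra.induction_on with
  | h0 => rw [zero_mul, zero_mul, map_zero]
  | hadd f g hf hg => rw [add_mul, add_mul, map_add, hf, hg, add_zero]
  | hpath r p =>
    induction v using PathAlgebra.induction_on with
    | h0 => rw [mul_zero, map_zero]
    | hadd f g hf hg => rw [mul_add, map_add, hf, hg, add_zero]
    | hpath s q => rw [smul_mul_assoc, smul_mul_assoc, mul_smul_comm, map_smul, map_smul, h,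
        smul_zero, smul_zero]

theorem relationsOne_mem {x : PathAlgebra K Γ.QVertex} (hx : x ∈ Γ.relationsOne K) :
    x ∈ Γ.formKernel K := by
  classical
  obtain ⟨a, b, hab, rfl⟩ := hx
  refine mem_formKernel K fun {V W X Y} p q => ?_
  rw [cycleElt_pow, cycleElt_pow]
  change Γ.pathForm K (_ * (word K (List.iterate Γ.next a a.fullLength) -
    word K (List.iterate Γ.next b b.fullLength)) * _) = 0
  have ha := a.two_le_fullLength
  have hb := b.two_le_fullLength
  by_cases h : pathArrows p ≠ [] ∨ pathArrows q ≠ []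
  · have key : ∀ c : Γ.Arrow, Γ.pathForm K (PathAlgebra.ofPath K p *
        word K (List.iterate Γ.next c c.fullLength) * PathAlgebra.ofPath K q) = 0 := fun c =>
      pathForm_mul_word_mul K p q
        (by have := c.two_le_fullLength; rw [Ne, List.iterate_eq_nil]; omega)
        (not_isFull_append c h)
    rw [mul_sub, sub_mul, map_sub, key, key, sub_zero]
  · push Not at h
    cases p with
    | cons p f => simp [pathArrows] at h
    | nil =>
    cases q with
    | cons q f => simp [pathArrows] at h
    | nil =>
    -- Between trivial paths the value depends on the full cycle only through its starting vertex,
    -- which the two terms of the relation share.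
    have key : ∀ c : Γ.Arrow, Γ.pathForm K (Γ.vertexElt K V *
        word K (List.iterate Γ.next c c.fullLength) * Γ.vertexElt K X) =
        if c.start = V then if c.start = X then 1 else 0 else 0 := by
      intro c
      have hc := c.two_le_fullLength
      obtain ⟨m, hm⟩ : ∃ m, c.fullLength = m + 1 := ⟨c.fullLength - 1, by omega⟩
      have h1 := vertexElt_mul_word_iterate K c m
      have h2 := word_iterate_mul_vertexElt K c m X
      have h3 := pathForm_vertexElt_mul_word K c c.fullLength
      rw [← hm] at h1 h2
      rw [start_next_iterate_fullLength] at h2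
      rw [if_pos rfl] at h3
      by_cases hV : c.start = V
      · subst hV
        rw [h1, h2, if_pos rfl]
        split_ifs
        · rw [← h1, h3]
        · rw [map_zero]
      · rw [← h1, ← mul_assoc, vertexElt_mul_vertexElt, if_neg (Ne.symm hV), if_neg hV, zero_mul,
          zero_mul, map_zero]
    change Γ.pathForm K (Γ.vertexElt K V * (_ - _) * Γ.vertexElt K X) = 0
    rw [mul_sub, sub_mul, map_sub, key, key, show a.start = b.start from hab, sub_self]

theorem relationsTwo_mem {x : PathAlgebra K Γ.QVertex} (hx : x ∈ Γ.relationsTwo K) :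
    x ∈ Γ.formKernel K := by
  obtain ⟨a, rfl⟩ := hx
  refine mem_formKernel K fun {V W X Y} p q => ?_
  rw [cycleElt_pow, ← word_singleton, ← word_append]
  refine pathForm_mul_word_mul K p q (by simp) ?_
  rw [← List.append_assoc, List.append_assoc _ [a]]
  exact not_isFull_append a (Or.inr (by simp))

theorem relationsThree_mem {x : PathAlgebra K Γ.QVertex} (hx : x ∈ Γ.relationsThree K) :
    x ∈ Γ.formKernel K := by
  obtain ⟨a, b, -, h1, h2, rfl⟩ := hx
  refine mem_formKernel K fun {V W X Y} p q => ?_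
  rw [← word_singleton, ← word_singleton, ← word_append]
  exact pathForm_mul_word_mul K p q (by simp) (not_isFull_of_ne_next (ne_next_iff.2 ⟨h1, h2⟩) _ _)

/-- `formKernel` is a two-sided ideal containing the generators, hence all of the relation ideal;
taking `u = v = 1` gives the claim. -/
theorem pathForm_eq_zero_of_mem {x : PathAlgebra K Γ.QVertex} (hx : x ∈ Γ.relationIdeal K) :
    Γ.pathForm K x = 0 := by
  have hle : Γ.relationIdeal K ≤ Γ.formKernel K := by
    rw [relationIdeal, TwoSidedIdeal.span_le]
    rintro x ((hx | hx) | hx)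
    exacts [relationsOne_mem K hx, relationsTwo_mem K hx, relationsThree_mem K hx]
  have h := hle hx
  rw [formKernel, TwoSidedIdeal.mem_mk'] at h
  simpa using h 1 1

end Words

/-! ### Runs in the quotient and the symmetrizing form -/

section Quotient

variable (K : Type*) [CommRing K] {Γ : BrauerConfiguration Γ₀ Γ₁}

/-- The projection from the path algebra onto the Brauer configuration algebra. -/
noncomputable def proj (Γ : BrauerConfiguration Γ₀ Γ₁) :
    PathAlgebra K Γ.QVertex →ₐ[K] Γ.brauerAlgebra K :=
  (Γ.relationIdeal K).ringCon.mkₐ (α := K)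

theorem proj_surjective : Function.Surjective (Γ.proj K) := RingCon.mkₐ_surjective _

theorem proj_eq_iff {x y : PathAlgebra K Γ.QVertex} :
    Γ.proj K x = Γ.proj K y ↔ x - y ∈ Γ.relationIdeal K := by
  rw [← TwoSidedIdeal.rel_iff]
  exact RingCon.eq _

/-- The idempotent of a vertex of the quiver. -/
noncomputable def idem (Γ : BrauerConfiguration Γ₀ Γ₁) (V : Γ.QVertex) : Γ.brauerAlgebra K :=
  Γ.proj K (Γ.vertexElt K V)

/-- The class of the path of length `k` that starts with the arrow `a` and stays at the vertex of
`a`. -/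
noncomputable def run (a : Γ.Arrow) (k : ℕ) : Γ.brauerAlgebra K :=
  Γ.proj K (Γ.vertexElt K a.start * word K (List.iterate Γ.next a k))

theorem run_zero (a : Γ.Arrow) : run K a 0 = Γ.idem K a.start := by
  rw [run, List.iterate, word_nil, mul_one, idem]

theorem run_succ (a : Γ.Arrow) (k : ℕ) :
    run K a (k + 1) = Γ.proj K (word K (List.iterate Γ.next a (k + 1))) := by
  rw [run, vertexElt_mul_word_iterate]

theorem run_one (a : Γ.Arrow) : run K a 1 = Γ.proj K (Γ.arrowElt K a) := by
  rw [run_succ]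
  exact congrArg _ (word_singleton K a)

open Classical in
theorem idem_mul_idem (V W : Γ.QVertex) :
    Γ.idem K V * Γ.idem K W = if V = W then Γ.idem K V else 0 := by
  rw [idem, idem, ← map_mul, vertexElt_mul_vertexElt]
  split_ifs <;> simp

open Classical in
theorem idem_mul_run (V : Γ.QVertex) (a : Γ.Arrow) (k : ℕ) :
    Γ.idem K V * run K a k = if a.start = V then run K a k else 0 := by
  rw [idem, run, ← map_mul, ← mul_assoc, vertexElt_mul_vertexElt]
  by_cases h : a.start = V
  · rw [if_pos h.symm, if_pos h, h]
  · rw [if_neg (Ne.symm h), if_neg h, zero_mul, map_zero]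

open Classical in
theorem run_mul_idem (a : Γ.Arrow) (k : ℕ) (V : Γ.QVertex) :
    run K a k * Γ.idem K V = if (Γ.next^[k] a).start = V then run K a k else 0 := by
  cases k with
  | zero => rw [run_zero, idem_mul_idem]; rfl
  | succ k =>
    rw [run_succ, idem, ← map_mul, word_iterate_mul_vertexElt]
    split_ifs <;> simp

theorem run_mul_run_next (a : Γ.Arrow) (k l : ℕ) :
    run K a k * run K (Γ.next^[k] a) l = run K a (k + l) := by
  classical
  cases k with
  | zero => rw [run_zero, Function.iterate_zero, id, idem_mul_run, if_pos rfl, zero_add]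
  | succ k =>
    cases l with
    | zero => rw [run_zero, run_mul_idem, if_pos rfl, add_zero]
    | succ l =>
      rw [run_succ, run_succ, ← add_assoc, run_succ, ← map_mul, ← word_append,
        ← List.iterate_add]
      rfl

theorem arrow_mul_arrow_of_ne {a b : Γ.Arrow} (h : b ≠ Γ.next a) :
    run K a 1 * run K b 1 = 0 := by
  rw [run_one, run_one, ← map_mul]
  by_cases hs : (Γ.next a).start = b.start
  · rw [← map_zero (Γ.proj K), proj_eq_iff, sub_zero]
    exact TwoSidedIdeal.subset_span
      (Or.inr ⟨a, b, hs, (ne_next_iff.1 h).1, (ne_next_iff.1 h).2, rfl⟩)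
  · rw [arrowElt_mul_arrowElt_of_ne K hs, map_zero]

/-- Only the junction matters: the last arrow of the first run times the first arrow of the second
is already zero. -/
theorem run_mul_run_of_ne {a b : Γ.Arrow} {k l : ℕ} (hk : 0 < k) (hl : 0 < l)
    (h : b ≠ Γ.next^[k] a) : run K a k * run K b l = 0 := by
  obtain ⟨k, rfl⟩ : ∃ m, k = m + 1 := ⟨k - 1, by omega⟩
  obtain ⟨l, rfl⟩ : ∃ m, l = 1 + m := ⟨l - 1, by omega⟩
  rw [Function.iterate_succ_apply'] at h
  rw [← run_mul_run_next K a k 1, ← run_mul_run_next K b 1 l, mul_assoc,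
    ← mul_assoc (run K (Γ.next^[k] a) 1), arrow_mul_arrow_of_ne K h, zero_mul, mul_zero]

open Classical in
theorem run_mul_run {a b : Γ.Arrow} {k l : ℕ} (hk : 0 < k) (hl : 0 < l) :
    run K a k * run K b l = if b = Γ.next^[k] a then run K a (k + l) else 0 := by
  split_ifs with h
  · rw [h, run_mul_run_next]
  · exact run_mul_run_of_ne K hk hl h

theorem proj_cycleElt_pow (a : Γ.Arrow) :
    Γ.proj K (Γ.cycleElt K a ^ Γ.μ a.1.1) = run K a a.fullLength := by
  have := a.two_le_fullLength
  obtain ⟨m, hm⟩ : ∃ m, a.fullLength = m + 1 := ⟨a.fullLength - 1, by omega⟩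
  rw [cycleElt_pow, hm, run_succ, ← hm, Arrow.fullLength]

theorem run_fullLength_congr {a b : Γ.Arrow} (h : a.start = b.start) :
    run K a a.fullLength = run K b b.fullLength := by
  rw [← proj_cycleElt_pow, ← proj_cycleElt_pow, proj_eq_iff]
  exact TwoSidedIdeal.subset_span (Or.inl (Or.inl ⟨a, b, h, rfl⟩))

/-- A run longer than the full cycle begins with `C ^ μ(α)` followed by the first arrow of `C`, a
type two relation. -/
theorem run_eq_zero {a : Γ.Arrow} {k : ℕ} (h : a.fullLength < k) : run K a k = 0 := by
  have h1 : run K a (a.fullLength + 1) = 0 := by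
    rw [← run_mul_run_next K a a.fullLength 1, next_iterate_fullLength, run_one,
      ← proj_cycleElt_pow, ← map_mul, ← map_zero (Γ.proj K), proj_eq_iff, sub_zero]
    exact TwoSidedIdeal.subset_span (Or.inl (Or.inr ⟨a, rfl⟩))
  obtain ⟨m, rfl⟩ : ∃ m, k = a.fullLength + 1 + m := ⟨k - (a.fullLength + 1), by omega⟩
  rw [← run_mul_run_next, h1, zero_mul]

theorem exists_seq_eq {α : Γ₀} {V : Γ₁} (h : α ∈ Γ.polygon V) : ∃ i, Γ.seq α i = V := by
  have hpos : 0 < Nat.card {i // Γ.seq α i = V} := by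
    rw [Γ.seq_count]
    exact Multiset.count_pos.2 h
  obtain ⟨i, hi⟩ := (Nat.card_pos_iff.1 hpos).1
  exact ⟨i, hi⟩

theorem exists_source_eq (Γ : BrauerConfiguration Γ₀ Γ₁) (V : Γ₁) :
    ∃ a : Γ.Arrow, Γ.source a = V := by
  obtain ⟨α, hα, h⟩ := Γ.exists_nontruncated V
  obtain ⟨i, hi⟩ := exists_seq_eq hα
  exact ⟨⟨⟨α, fun ht => by rw [Truncated, mul_comm] at ht; omega⟩, i⟩, hi⟩

theorem exists_arrow_start (Γ : BrauerConfiguration Γ₀ Γ₁) (V : Γ.QVertex) :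
    ∃ a : Γ.Arrow, a.start = V := exists_source_eq Γ V

theorem proj_ofPath_eq {V W : Γ.QVertex} (p : Quiver.Path V W) :
    Γ.proj K (PathAlgebra.ofPath K p) = 0 ∨
      ∃ a k, k ≤ a.fullLength ∧ Γ.proj K (PathAlgebra.ofPath K p) = run K a k := by
  classical
  induction p with
  | nil =>
    -- Every polygon has a nontruncated vertex, so the idempotent at `V` is a run of length zero.
    obtain ⟨a, ha⟩ := exists_arrow_start Γ V
    exact Or.inr ⟨a, 0, Nat.zero_le _, by rw [run_zero, ha]; rfl⟩
  | cons p f ih =>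
    rw [ofPath_cons, map_mul, ← run_one]
    rcases ih with h | ⟨a, k, -, h⟩
    · exact Or.inl (by rw [h, zero_mul])
    · rw [h]
      generalize f.1 = b
      rcases Nat.eq_zero_or_pos k with rfl | hk
      · rw [run_zero, idem_mul_run]
        split_ifs
        · exact Or.inr ⟨b, 1, by have := b.two_le_fullLength; omega, rfl⟩
        · exact Or.inl rfl
      · rw [run_mul_run K hk one_pos]
        split_ifs
        · rcases Nat.lt_or_ge a.fullLength (k + 1) with h | h
          · exact Or.inl (run_eq_zero K h)
          · exact Or.inr ⟨a, _, h, rfl⟩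
        · exact Or.inl rfl

theorem run_induction {P : Γ.brauerAlgebra K → Prop} (h0 : P 0)
    (hadd : ∀ x y, P x → P y → P (x + y)) (hsmul : ∀ (r : K) x, P x → P (r • x))
    (hrun : ∀ (a : Γ.Arrow) (k : ℕ), k ≤ a.fullLength → P (run K a k)) (x : Γ.brauerAlgebra K) :
    P x := by
  obtain ⟨x, rfl⟩ := proj_surjective K x
  induction x using PathAlgebra.induction_on with
  | h0 => rwa [map_zero]
  | hadd f g hf hg => rw [map_add]; exact hadd _ _ hf hg
  | hpath r p =>
    rw [map_smul]
    refine hsmul _ _ ?_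
    rcases proj_ofPath_eq K p with h | ⟨a, k, hk, h⟩
    · rwa [h]
    · rw [h]; exact hrun a k hk

/-- The symmetrizing form of the Brauer configuration algebra. -/
noncomputable def form (Γ : BrauerConfiguration Γ₀ Γ₁) : Γ.brauerAlgebra K →ₗ[K] K where
  toFun := Quotient.lift (s := (Γ.relationIdeal K).ringCon.toSetoid) (Γ.pathForm K) fun x y h => by
    rw [← sub_eq_zero, ← map_sub]
    exact pathForm_eq_zero_of_mem K (TwoSidedIdeal.rel_iff _ _ _ |>.1 h)
  map_add' x y := by
    obtain ⟨x, rfl⟩ := proj_surjective K x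
    obtain ⟨y, rfl⟩ := proj_surjective K y
    exact map_add (Γ.pathForm K) x y
  map_smul' r x := by
    obtain ⟨x, rfl⟩ := proj_surjective K x
    exact map_smul (Γ.pathForm K) r x

theorem form_proj (x : PathAlgebra K Γ.QVertex) : Γ.form K (Γ.proj K x) = Γ.pathForm K x := rfl

open Classical in
theorem form_run (a : Γ.Arrow) (k : ℕ) :
    Γ.form K (run K a k) = if k = a.fullLength then 1 else 0 := by
  rw [run, form_proj, pathForm_vertexElt_mul_word]

open Classical in
theorem form_run_mul_run {a b : Γ.Arrow} {k l : ℕ} (hk : 0 < k) (hl : 0 < l) :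
    Γ.form K (run K a k * run K b l) =
      if b = Γ.next^[k] a ∧ k + l = a.fullLength then 1 else 0 := by
  rw [run_mul_run K hk hl, ite_and]
  split_ifs with h1 h2
  · rw [form_run, if_pos h2]
  · rw [form_run, if_neg h2]
  · exact map_zero _

open Classical in
theorem form_run_mul_idem (a : Γ.Arrow) (k : ℕ) (V : Γ.QVertex) :
    Γ.form K (run K a k * Γ.idem K V) = if a.start = V ∧ k = a.fullLength then 1 else 0 := by
  rw [run_mul_idem]
  by_cases hk : k = a.fullLength
  · rw [hk, start_next_iterate_fullLength]
    split_ifs with h1 h2 h2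
    · rw [form_run, if_pos rfl]
    · exact absurd ⟨h1, rfl⟩ h2
    · exact absurd h2.1 h1
    · exact map_zero _
  · rw [if_neg (fun h : a.start = V ∧ _ => hk h.2)]
    split_ifs
    · rw [form_run, if_neg hk]
    · exact map_zero _

open Classical in
theorem form_idem_mul_run (a : Γ.Arrow) (k : ℕ) (V : Γ.QVertex) :
    Γ.form K (Γ.idem K V * run K a k) = if a.start = V ∧ k = a.fullLength then 1 else 0 := by
  rw [idem_mul_run, ite_and]
  split_ifs with h1 h2
  · rw [form_run, if_pos h2]
  · rw [form_run, if_neg h2]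
  · exact map_zero _

theorem form_mul_comm (x y : Γ.brauerAlgebra K) : Γ.form K (x * y) = Γ.form K (y * x) := by
  classical
  induction x using run_induction with
  | h0 => rw [zero_mul, mul_zero]
  | hadd x x' hx hx' => rw [add_mul, mul_add, map_add, map_add, hx, hx']
  | hsmul r x hx => rw [smul_mul_assoc, mul_smul_comm, map_smul, map_smul, hx]
  | hrun a k hk =>
    induction y using run_induction with
    | h0 => rw [zero_mul, mul_zero]
    | hadd x x' hx hx' => rw [add_mul, mul_add, map_add, map_add, hx, hx']
    | hsmul r x hx => rw [smul_mul_assoc, mul_smul_comm, map_smul, map_smul, hx]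
    | hrun b l hl =>
      rcases Nat.eq_zero_or_pos k with rfl | hk
      · rw [run_zero, form_idem_mul_run, form_run_mul_idem]
      rcases Nat.eq_zero_or_pos l with rfl | hl
      · rw [run_zero, form_idem_mul_run, form_run_mul_idem]
      rw [form_run_mul_run K hk hl, form_run_mul_run K hl hk]
      -- Two runs that together make a full cycle also make one, rotated, in the opposite order.
      have key : ∀ {a b : Γ.Arrow} {k l : ℕ}, (b = Γ.next^[k] a ∧ k + l = a.fullLength) →
          (a = Γ.next^[l] b ∧ l + k = b.fullLength) := by
        rintro a b k l ⟨rfl, h⟩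
        rw [← Function.iterate_add_apply, fullLength_next_iterate, Nat.add_comm l k, h,
          next_iterate_fullLength]
        exact ⟨rfl, rfl⟩
      exact if_congr ⟨key, key⟩ rfl rfl

end Quotient

/-! ### Dual generators and nondegeneracy of the form -/

section Nondegenerate

theorem next_injective (Γ : BrauerConfiguration Γ₀ Γ₁) : Function.Injective Γ.next := by
  intro a b h
  have h1 : a.1 = b.1 := by rw [← next_fst a, h, next_fst]
  have h2 := a.two_le_fullLength
  -- Completing the full cycle with `fullLength - 1` further steps undoes `next`.
  have h3 : ∀ c : Γ.Arrow, Γ.next^[c.fullLength - 1] (Γ.next c) = c := fun c => by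
    have := c.two_le_fullLength
    rw [← Function.iterate_succ_apply, show (c.fullLength - 1).succ = c.fullLength by omega,
      next_iterate_fullLength]
  rw [← h3 a, ← h3 b, h, fullLength_congr h1]

/-- An arrow of the quiver that starts at `V`. -/
noncomputable def arrowAt (Γ : BrauerConfiguration Γ₀ Γ₁) (V : Γ.QVertex) : Γ.Arrow :=
  (exists_arrow_start Γ V).choose

@[simp] theorem arrowAt_start (Γ : BrauerConfiguration Γ₀ Γ₁) (V : Γ.QVertex) :
    (Γ.arrowAt V).start = V := (exists_arrow_start Γ V).choose_spec

variable (K : Type*) [CommRing K] {Γ : BrauerConfiguration Γ₀ Γ₁}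

theorem form_run_mul_run_eq_zero {a b : Γ.Arrow} {k l : ℕ} (hk : 0 < k) (hl : 0 < l)
    (h : b = Γ.next^[k] a → k + l ≠ a.fullLength) : Γ.form K (run K a k * run K b l) = 0 := by
  rw [form_run_mul_run K hk hl, if_neg (fun h' => h h'.1 h'.2)]

theorem form_run_mul_idem_eq_zero {a : Γ.Arrow} {k : ℕ} (V : Γ.QVertex) (h : k ≠ a.fullLength) :
    Γ.form K (run K a k * Γ.idem K V) = 0 := by
  rw [form_run_mul_idem, if_neg (fun h' => h h'.2)]

-- Expansion in dual families: an idempotent is dual to the full cycle at its vertex, and a run of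
-- intermediate length to the run that completes it. By linearity only runs need checking, and for
-- each of them exactly one term survives.
open Classical in
theorem eq_sum_form_smul [Fintype Γ₀] (x : Γ.brauerAlgebra K) :
    x = ∑ V : Γ.QVertex,
          Γ.form K (x * run K (Γ.arrowAt V) (Γ.arrowAt V).fullLength) • Γ.idem K V
      + ∑ a : Γ.Arrow, ∑ k ∈ Finset.Ico 1 a.fullLength,
          Γ.form K (x * run K (Γ.next^[k] a) (a.fullLength - k)) • run K a k
      + ∑ V : Γ.QVertex, Γ.form K (x * Γ.idem K V) •
          run K (Γ.arrowAt V) (Γ.arrowAt V).fullLength := by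
  induction x using run_induction with
  | h0 => simp
  | hadd x y hx hy =>
    conv_lhs => rw [hx, hy]
    simp only [add_mul, map_add, add_smul, Finset.sum_add_distrib]
    abel
  | hsmul r x hx =>
    conv_lhs => rw [hx]
    simp only [smul_mul_assoc, map_smul, smul_assoc, smul_add, Finset.smul_sum]
  | hrun b l hl =>
    have hb := b.two_le_fullLength
    rcases Nat.eq_zero_or_pos l with rfl | hl0
    · have h1 : ∀ V : Γ.QVertex,
          Γ.form K (run K b 0 * run K (Γ.arrowAt V) (Γ.arrowAt V).fullLength) =
            if V = b.start then 1 else 0 := fun V => by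
        rw [run_zero, form_idem_mul_run]; simp
      have h2 : ∑ a : Γ.Arrow, ∑ k ∈ Finset.Ico 1 a.fullLength,
          Γ.form K (run K b 0 * run K (Γ.next^[k] a) (a.fullLength - k)) • run K a k = 0 :=
        Finset.sum_eq_zero fun a _ => Finset.sum_eq_zero fun k hk => by
          have ha := a.two_le_fullLength
          rw [Finset.mem_Ico] at hk
          rw [run_zero, form_idem_mul_run, fullLength_next_iterate,
            if_neg (fun h => by omega), zero_smul]
      have h3 : ∀ V : Γ.QVertex, Γ.form K (run K b 0 * Γ.idem K V) = 0 := fun V =>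
        form_run_mul_idem_eq_zero K V (by omega)
      simp only [h1, h2, h3, ite_smul, one_smul, zero_smul, Finset.sum_const_zero, add_zero,
        Finset.sum_ite_eq', Finset.mem_univ, if_true]
      exact run_zero K b
    · have h1 : ∀ V : Γ.QVertex,
          Γ.form K (run K b l * run K (Γ.arrowAt V) (Γ.arrowAt V).fullLength) = 0 := fun V => by
        have := (Γ.arrowAt V).two_le_fullLength
        refine form_run_mul_run_eq_zero K hl0 (by omega) fun h => ?_
        rw [h, fullLength_next_iterate]
        omega
      have h2 : ∀ a : Γ.Arrow, ∀ k ∈ Finset.Ico 1 a.fullLength,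
          Γ.form K (run K b l * run K (Γ.next^[k] a) (a.fullLength - k)) • run K a k =
            if k = l then if a = b then run K b l else 0 else 0 := fun a k hk => by
        rw [Finset.mem_Ico] at hk
        rw [form_run_mul_run K hl0 (by omega)]
        by_cases hkl : k = l
        · subst hkl
          rw [if_pos rfl]
          by_cases hab : a = b
          · subst hab
            rw [if_pos ⟨rfl, by omega⟩, if_pos rfl, one_smul]
          · rw [if_neg (fun h => hab ((next_injective Γ).iterate k h.1)), if_neg hab, zero_smul]
        · rw [if_neg hkl, if_neg, zero_smul]
          rintro ⟨h, h'⟩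
          have := congrArg Arrow.fullLength h
          rw [fullLength_next_iterate, fullLength_next_iterate] at this
          omega
      have h2' : ∑ a : Γ.Arrow, ∑ k ∈ Finset.Ico 1 a.fullLength,
          Γ.form K (run K b l * run K (Γ.next^[k] a) (a.fullLength - k)) • run K a k =
            if l < b.fullLength then run K b l else 0 := by
        rw [Finset.sum_eq_single b]
        · rw [Finset.sum_congr rfl (h2 b), Finset.sum_ite_eq']
          simp only [Finset.mem_Ico, if_true]
          exact if_congr ⟨fun h => h.2, fun h => ⟨hl0, h⟩⟩ rfl rfl
        · intro a _ hab
          rw [Finset.sum_congr rfl (h2 a)]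
          simp [hab]
        · exact fun h => absurd (Finset.mem_univ b) h
      simp only [h1, h2', zero_smul, Finset.sum_const_zero, zero_add, form_run_mul_idem, ite_and]
      -- A shorter run is recovered from the middle sum, a full one from the socle sum; type one
      -- relations identify it with the chosen full cycle at its vertex.
      rcases hl.lt_or_eq with hl | rfl
      · simp [hl, hl.ne]
      · simp only [lt_irrefl, if_false, if_true, zero_add, ite_smul, one_smul, zero_smul,
          Finset.sum_ite_eq, Finset.mem_univ]
        exact run_fullLength_congr K (by rw [arrowAt_start])

theorem eq_zero_of_form_mul_run [Finite Γ₀] {x : Γ.brauerAlgebra K}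
    (h : ∀ (a : Γ.Arrow) (k : ℕ), k ≤ a.fullLength → Γ.form K (x * run K a k) = 0) : x = 0 := by
  classical
  have := Fintype.ofFinite Γ₀
  have h0 : ∀ V : Γ.QVertex, Γ.form K (x * Γ.idem K V) = 0 := fun V => by
    rw [← arrowAt_start Γ V, ← run_zero]
    exact h _ _ (Nat.zero_le _)
  rw [eq_sum_form_smul K x]
  have h2 : ∀ (a : Γ.Arrow) (k : ℕ),
      Γ.form K (x * run K (Γ.next^[k] a) (a.fullLength - k)) = 0 := fun a k =>
    h _ _ (by rw [fullLength_next_iterate]; omega)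
  simp [h0, h2, fun a => h a a.fullLength le_rfl]

end Nondegenerate

/-! ### Central elements as functionals vanishing on commutators -/

section Center

variable (K : Type*) [CommRing K] {Γ : BrauerConfiguration Γ₀ Γ₁}

theorem mem_center_of_commute_run {z : Γ.brauerAlgebra K}
    (h : ∀ (a : Γ.Arrow) (k : ℕ), run K a k * z = z * run K a k) :
    z ∈ Subalgebra.center K (Γ.brauerAlgebra K) := by
  rw [Subalgebra.mem_center_iff]
  intro x
  induction x using run_induction with
  | h0 => rw [zero_mul, mul_zero]
  | hadd x y hx hy => rw [add_mul, mul_add, hx, hy]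
  | hsmul r x hx => rw [smul_mul_assoc, mul_smul_comm, hx]
  | hrun a k _ => exact h a k

theorem form_central_mul_mul {z : Γ.brauerAlgebra K}
    (hz : z ∈ Subalgebra.center K (Γ.brauerAlgebra K)) (x y : Γ.brauerAlgebra K) :
    Γ.form K (z * (x * y)) = Γ.form K (z * (y * x)) := by
  rw [← mul_assoc, ← Subalgebra.mem_center_iff.1 hz x, mul_assoc, form_mul_comm, mul_assoc]

/-- The run is closed, so moving its first arrow to the end is a commutator and yields the run
starting one position later. -/
theorem form_central_mul_run_next {z : Γ.brauerAlgebra K}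
    (hz : z ∈ Subalgebra.center K (Γ.brauerAlgebra K)) (a : Γ.Arrow) {k : ℕ} (hk : 0 < k)
    (hd : Γ.val a.1.1 ∣ k) :
    Γ.form K (z * run K a k) = Γ.form K (z * run K (Γ.next a) k) := by
  obtain ⟨m, rfl⟩ : ∃ m, k = 1 + m := ⟨k - 1, by omega⟩
  have h : Γ.next^[m] (Γ.next a) = a := by
    rw [← Function.iterate_succ_apply, next_iterate_eq_self_iff, Nat.succ_eq_add_one, add_comm]
    exact hd
  have h2 := run_mul_run_next K (Γ.next a) m 1
  rw [h] at h2
  rw [← run_mul_run_next K a 1 m, form_central_mul_mul K hz]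
  change Γ.form K (z * (run K (Γ.next a) m * run K a 1)) = _
  rw [h2, add_comm]

theorem form_central_mul_run_congr {z : Γ.brauerAlgebra K}
    (hz : z ∈ Subalgebra.center K (Γ.brauerAlgebra K)) {a b : Γ.Arrow} (hab : a.1 = b.1) {k : ℕ}
    (hk : 0 < k) (hd : Γ.val a.1.1 ∣ k) :
    Γ.form K (z * run K a k) = Γ.form K (z * run K b k) := by
  obtain ⟨m, rfl⟩ := exists_next_iterate hab
  clear hab
  induction m with
  | zero => rfl
  | succ m ih =>
    rw [ih, Function.iterate_succ_apply']
    exact form_central_mul_run_next K hz _ hk (by rwa [next_iterate_fst])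

/-- Such a run is the commutator of the idempotent at its start with itself. -/
theorem form_central_mul_run_eq_zero {z : Γ.brauerAlgebra K}
    (hz : z ∈ Subalgebra.center K (Γ.brauerAlgebra K)) (a : Γ.Arrow) {k : ℕ}
    (h : (Γ.next^[k] a).start ≠ a.start) : Γ.form K (z * run K a k) = 0 := by
  classical
  have h1 := idem_mul_run K a.start a k
  rw [if_pos rfl] at h1
  rw [← h1, form_central_mul_mul K hz, run_mul_idem, if_neg h, mul_zero, map_zero]

theorem val_pos (Γ : BrauerConfiguration Γ₀ Γ₁) (α : Γ₀) : 0 < Γ.val α := by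
  obtain ⟨V, hV⟩ := Γ.exists_polygon α
  exact (Multiset.count_pos.2 hV).trans_le
    (Finset.single_le_sum (f := fun V => Γ.occ α V) (fun _ _ => Nat.zero_le _) (Finset.mem_univ V))

/-- The arrow in position zero of the successor sequence of a nontruncated vertex. -/
def firstArrow (α : {α : Γ₀ // ¬ Γ.Truncated α}) : Γ.Arrow := ⟨α, ⟨0, Γ.val_pos α⟩⟩

/-- The index set of a basis of the center. -/
abbrev CenterIndex (Γ : BrauerConfiguration Γ₀ Γ₁) :=
  Unit ⊕ ((Σ α : {α : Γ₀ // ¬ Γ.Truncated α}, Fin (Γ.μ α - 1)) ⊕ Γ.QVertex)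

/-- A basis of the center: the unit, the sums of the powers of the special cycles at a vertex, and
the socle elements. -/
noncomputable def centerBasis (Γ : BrauerConfiguration Γ₀ Γ₁) :
    Γ.CenterIndex → Γ.brauerAlgebra K
  | .inl _ => 1
  | .inr (.inl ⟨α, j⟩) =>
      ∑ i : Fin (Γ.val α), run K (⟨α, i⟩ : Γ.Arrow) (Γ.val α * (Γ.μ α - 1 - j))
  | .inr (.inr V) => run K (Γ.arrowAt V) (Γ.arrowAt V).fullLength

/-- Elements that pair with `centerBasis` to the identity matrix. -/
noncomputable def centerDual (Γ : BrauerConfiguration Γ₀ Γ₁) (V₀ : Γ.QVertex) :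
    Γ.CenterIndex → Γ.brauerAlgebra K
  | .inl _ => run K (Γ.arrowAt V₀) (Γ.arrowAt V₀).fullLength
  | .inr (.inl ⟨α, j⟩) => run K (firstArrow α) (Γ.val α * (j + 1))
  | .inr (.inr V) => Γ.idem K V

theorem run_fullLength_mul_run {a b : Γ.Arrow} {k : ℕ} (hk : 0 < k) :
    run K a a.fullLength * run K b k = 0 := by
  classical
  have := a.two_le_fullLength
  rw [run_mul_run K (by omega) hk, run_eq_zero K (by omega), ite_self]

theorem run_mul_run_fullLength {a b : Γ.Arrow} {k : ℕ} (hk : 0 < k) :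
    run K b k * run K a a.fullLength = 0 := by
  classical
  have := a.two_le_fullLength
  rw [run_mul_run K hk (by omega)]
  split_ifs with h
  · exact run_eq_zero K (by rw [h, fullLength_next_iterate]; omega)
  · rfl

theorem sum_run_mem_center (α : {α : Γ₀ // ¬ Γ.Truncated α}) {k : ℕ} (hk : 0 < k)
    (hd : Γ.val α ∣ k) :
    ∑ i : Fin (Γ.val α), run K (⟨α, i⟩ : Γ.Arrow) k ∈
      Subalgebra.center K (Γ.brauerAlgebra K) := by
  classical
  have hself : ∀ i : Fin (Γ.val α), Γ.next^[k] (⟨α, i⟩ : Γ.Arrow) = ⟨α, i⟩ := fun i =>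
    (next_iterate_eq_self_iff _ _).2 hd
  refine mem_center_of_commute_run K fun b l => ?_
  rw [Finset.mul_sum, Finset.sum_mul]
  rcases Nat.eq_zero_or_pos l with rfl | hl
  · simp only [run_zero, idem_mul_run, run_mul_idem, hself]
  · simp only [run_mul_run K hl hk, run_mul_run K hk hl, hself]
    obtain ⟨β, j⟩ := b
    by_cases h : β = α
    · subst h
      obtain ⟨i, hi⟩ : ∃ i, Γ.next^[l] (⟨β, j⟩ : Γ.Arrow) = ⟨β, i⟩ := ⟨_, next_iterate_eq _ _ _⟩
      simp [hi, add_comm]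
    · refine (Finset.sum_eq_zero fun i _ => if_neg fun h' => h ?_).trans
        (Finset.sum_eq_zero fun i _ => if_neg fun h' => h ?_).symm
      · have := congrArg Sigma.fst h'
        rw [next_iterate_fst] at this
        exact this.symm
      · exact congrArg Sigma.fst h'

theorem centerBasis_mem_center (i : Γ.CenterIndex) :
    Γ.centerBasis K i ∈ Subalgebra.center K (Γ.brauerAlgebra K) := by
  classical
  rcases i with _ | ⟨α, j⟩ | V
  · exact one_mem _
  · exact sum_run_mem_center K α (Nat.mul_pos (Γ.val_pos α) (by omega)) (Dvd.intro _ rfl)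
  · refine mem_center_of_commute_run K fun a k => ?_
    rw [centerBasis]
    rcases Nat.eq_zero_or_pos k with rfl | hk
    · rw [run_zero, idem_mul_run, run_mul_idem, start_next_iterate_fullLength]
    · rw [run_fullLength_mul_run K hk, run_mul_run_fullLength K hk]

-- Index `j` stands for exponent `μ - 1 - j` in the basis and `j + 1` in the dual family. These add
-- up to `μ` exactly when the indices agree, and both range over `1, …, μ - 1`.
open Classical in
theorem form_centerBasis_mul_centerDual (V₀ : Γ.QVertex) (i j : Γ.CenterIndex) :
    Γ.form K (Γ.centerBasis K i * Γ.centerDual K V₀ j) = if i = j then 1 else 0 := by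
  have hlt : ∀ (α : {α : Γ₀ // ¬ Γ.Truncated α}) (m : ℕ), m < Γ.μ α →
      Γ.val α * m < (firstArrow α).fullLength := fun α m hm =>
    Nat.mul_lt_mul_of_pos_left hm (Γ.val_pos α)
  rcases i with _ | ⟨α, i⟩ | V
  · rcases j with _ | ⟨β, j⟩ | W
    · rw [centerBasis, centerDual, one_mul, form_run, if_pos rfl, if_pos rfl]
    · rw [centerBasis, centerDual, one_mul, form_run, if_neg (hlt β _ (by omega)).ne,
        if_neg (by simp)]
    · rw [centerBasis, centerDual, one_mul, ← arrowAt_start Γ W, ← run_zero, form_run, if_neg,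
        if_neg (by simp)]
      have := (Γ.arrowAt W).two_le_fullLength
      omega
  · have hk : 0 < Γ.val α * (Γ.μ α - 1 - i) := Nat.mul_pos (Γ.val_pos α) (by omega)
    rw [centerBasis, Finset.sum_mul, map_sum]
    rcases j with _ | ⟨β, j⟩ | W
    · rw [if_neg (by simp)]
      refine Finset.sum_eq_zero fun m _ => ?_
      rw [centerDual, run_mul_run_fullLength K hk, map_zero]
    · rw [centerDual]
      have hl : 0 < Γ.val β * (j + 1) := Nat.mul_pos (Γ.val_pos β) (by omega)
      simp only [form_run_mul_run K hk hl]
      have hself : ∀ m : Fin (Γ.val α),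
          Γ.next^[Γ.val α * (Γ.μ α - 1 - i)] (⟨α, m⟩ : Γ.Arrow) = ⟨α, m⟩ := fun m =>
        (next_iterate_eq_self_iff _ _).2 (Dvd.intro _ rfl)
      simp only [hself]
      by_cases hαβ : β = α
      · subst hαβ
        have hij : (Γ.val β * (Γ.μ β - 1 - i) + Γ.val β * (j + 1) = Γ.val β * Γ.μ β) ↔ i = j := by
          rw [← Nat.mul_add, Nat.mul_right_inj (Γ.val_pos β).ne', Fin.ext_iff]
          omega
        rw [Finset.sum_eq_single ⟨0, Γ.val_pos β⟩]
        · refine if_congr ?_ rfl rfl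
          simpa [firstArrow, Arrow.fullLength] using hij
        · intro m _ hm
          refine if_neg fun h => hm ?_
          have := eq_of_heq (Sigma.mk.inj h.1).2
          exact this.symm
        · exact fun h => absurd (Finset.mem_univ _) h
      · rw [if_neg]
        · exact Finset.sum_eq_zero fun m _ => if_neg fun h => hαβ (congrArg Sigma.fst h.1)
        · intro h
          simp only [Sum.inr.injEq, Sum.inl.injEq, Sigma.mk.injEq] at h
          exact hαβ h.1.symm
    · rw [if_neg (by simp)]
      refine Finset.sum_eq_zero fun m _ => ?_
      rw [centerDual]
      exact form_run_mul_idem_eq_zero K W (hlt α _ (by omega)).ne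
  · rw [centerBasis]
    rcases j with _ | ⟨β, j⟩ | W
    · have := (Γ.arrowAt V₀).two_le_fullLength
      rw [centerDual, run_fullLength_mul_run K (by omega), map_zero, if_neg (by simp)]
    · have hl : 0 < Γ.val β * (j + 1) := Nat.mul_pos (Γ.val_pos β) (by omega)
      rw [centerDual, run_fullLength_mul_run K hl, map_zero, if_neg (by simp)]
    · rw [centerDual, form_run_mul_idem, arrowAt_start]
      simp

/-- `hsource` says that a vertex meets each polygon at most once, so a run closes up only if the
valency divides its length; `hconn` is connectedness of the quiver, phrased through functions
constant along arrows. -/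
theorem central_eq_zero [Finite Γ₀]
    (hsource : ∀ a b : Γ.Arrow, a.1 = b.1 → a.start = b.start → a = b)
    (hconn : ∀ x : Γ.QVertex → K, (∀ a : Γ.Arrow, x a.start = x (Γ.next a).start) →
      ∀ V W, x V = x W)
    (V₀ : Γ.QVertex) {z : Γ.brauerAlgebra K} (hz : z ∈ Subalgebra.center K (Γ.brauerAlgebra K))
    (h : ∀ i, Γ.form K (z * Γ.centerDual K V₀ i) = 0) : z = 0 := by
  refine eq_zero_of_form_mul_run K fun a k hk => ?_
  rcases Nat.eq_zero_or_pos k with rfl | hk0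
  · rw [run_zero]
    exact h (.inr (.inr a.start))
  by_cases hd : Γ.val a.1.1 ∣ k
  · rcases hk.lt_or_eq with hk | rfl
    · obtain ⟨j, rfl⟩ := hd
      have hj0 : 0 < j := Nat.pos_of_mul_pos_left hk0
      have hj : j < Γ.μ a.1.1 := Nat.lt_of_mul_lt_mul_left hk
      have h1 := h (.inr (.inl ⟨a.1, ⟨j - 1, by omega⟩⟩))
      simp only [centerDual, Nat.sub_add_cancel hj0] at h1
      exact (form_central_mul_run_congr K hz (a := a) (b := firstArrow a.1) rfl hk0
        (Dvd.intro _ rfl)).trans h1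
    · have h1 : ∀ b : Γ.Arrow, Γ.form K (z * run K b b.fullLength) =
          Γ.form K (z * run K (Γ.arrowAt b.start) (Γ.arrowAt b.start).fullLength) := fun b => by
        rw [run_fullLength_congr K (arrowAt_start Γ b.start)]
      have h2 := hconn
        (fun V => Γ.form K (z * run K (Γ.arrowAt V) (Γ.arrowAt V).fullLength))
        (fun b => by
          have := b.two_le_fullLength
          rw [← h1, ← h1, fullLength_next]
          exact form_central_mul_run_next K hz b (by omega) (Dvd.intro _ rfl)) a.start V₀
      rw [h1]
      exact h2.trans (h (.inl ()))
  · refine form_central_mul_run_eq_zero K hz a fun hs => hd ?_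
    rw [← next_iterate_eq_self_iff]
    exact hsource _ _ (next_iterate_fst a k) hs

end Center

/-! ### The center in coordinates and the count of indices -/

section Dimension

variable (K : Type*) [Field K] {Γ : BrauerConfiguration Γ₀ Γ₁}

/-- If all polygons are sets and the quiver is connected, the center of the Brauer configuration
algebra has a basis indexed by `CenterIndex`. -/
theorem nonempty_center_equiv [Finite Γ₀]
    (hsource : ∀ a b : Γ.Arrow, a.1 = b.1 → a.start = b.start → a = b)
    (hconn : ∀ x : Γ.QVertex → K, (∀ a : Γ.Arrow, x a.start = x (Γ.next a).start) →
      ∀ V W, x V = x W)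
    (V₀ : Γ.QVertex) :
    Nonempty (Subalgebra.center K (Γ.brauerAlgebra K) ≃ₗ[K] (Γ.CenterIndex → K)) := by
  classical
  have := Fintype.ofFinite Γ₀
  let T : Subalgebra.center K (Γ.brauerAlgebra K) →ₗ[K] (Γ.CenterIndex → K) :=
    LinearMap.pi fun i => Γ.form K ∘ₗ LinearMap.mulRight K (Γ.centerDual K V₀ i) ∘ₗ
      (Subalgebra.center K (Γ.brauerAlgebra K)).val.toLinearMap
  have hT : ∀ z i, T z i = Γ.form K (z * Γ.centerDual K V₀ i) := fun z i => rfl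
  refine ⟨LinearEquiv.ofBijective T ⟨?_, fun f => ?_⟩⟩
  · rw [injective_iff_map_eq_zero]
    intro z hz
    refine Subtype.ext (central_eq_zero K hsource hconn V₀ z.2 fun i => ?_)
    rw [← hT, hz, Pi.zero_apply]
  · refine ⟨∑ i, f i • ⟨Γ.centerBasis K i, centerBasis_mem_center K i⟩, funext fun j => ?_⟩
    rw [map_sum, Finset.sum_apply]
    simp only [map_smul, Pi.smul_apply]
    simp only [hT, form_centerBasis_mul_centerDual, smul_eq_mul, mul_ite, mul_one, mul_zero,
      Finset.sum_ite_eq', Finset.mem_univ, if_true]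

theorem card_centerIndex [Fintype Γ₀] [Fintype Γ.CenterIndex] :
    (Fintype.card Γ.CenterIndex : ℤ) =
      1 + ∑ α : Γ₀, (Γ.μ α : ℤ) + (Fintype.card Γ₁ : ℤ) - (Fintype.card Γ₀ : ℤ) := by
  classical
  have h1 : ∑ α : {α : Γ₀ // ¬ Γ.Truncated α}, (Γ.μ α - 1) = ∑ α : Γ₀, (Γ.μ α - 1) := by
    have h0 : ∑ α : {α : Γ₀ // Γ.Truncated α}, (Γ.μ α - 1) = 0 :=
      Finset.sum_eq_zero fun α _ => by rw [Nat.eq_one_of_mul_eq_one_right α.2, Nat.sub_self]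
    rw [← Fintype.sum_subtype_add_sum_subtype Γ.Truncated, h0, zero_add]
  have h2 : ((∑ α : Γ₀, (Γ.μ α - 1) : ℕ) : ℤ) = ∑ α : Γ₀, (Γ.μ α : ℤ) - Fintype.card Γ₀ := by
    have : ∀ α, ((Γ.μ α - 1 : ℕ) : ℤ) = (Γ.μ α : ℤ) - 1 := fun α => by
      have := Γ.μ_pos α
      omega
    rw [Nat.cast_sum, Finset.sum_congr rfl fun α _ => this α]
    simp
  have h3 : Fintype.card Γ.CenterIndex =
      1 + (∑ α : {α : Γ₀ // ¬ Γ.Truncated α}, (Γ.μ α - 1) + Fintype.card Γ₁) := by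
    rw [← Nat.card_eq_fintype_card, Nat.card_sum, Nat.card_sum, Nat.card_sigma]
    simp only [Nat.card_unique, Nat.card_eq_fintype_card, Fintype.card_fin]
    rfl
  rw [h3, h1]
  push_cast [h2]
  ring

end Dimension

/-! ### What the tree hypothesis provides: simple incidence, connectedness, loops -/

section Tree

variable {Γ : BrauerConfiguration Γ₀ Γ₁}

theorem IsBrauerTree.arrow_ext (h : Γ.IsBrauerTree) (a b : Γ.Arrow) (hab : a.1 = b.1)
    (hs : a.start = b.start) : a = b := by
  obtain ⟨α, i⟩ := a
  obtain ⟨β, j⟩ := b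
  obtain rfl : α = β := hab
  have hs' : Γ.seq α i = Γ.seq α j := hs
  have hc : Nat.card {k // Γ.seq α k = Γ.seq α j} ≤ 1 := by
    rw [Γ.seq_count]
    exact Multiset.nodup_iff_count_le_one.1 (h.no_loops _) _
  have := Finite.card_le_one_iff_subsingleton.1 hc
  have hij := Subsingleton.elim (⟨i, hs'⟩ : {k // Γ.seq α k = Γ.seq α j}) ⟨j, rfl⟩
  exact congrArg (Sigma.mk α) (congrArg Subtype.val hij)

theorem eq_of_mem_polygon {X : Type*} {x : Γ.QVertex → X}
    (hx : ∀ a : Γ.Arrow, x a.start = x (Γ.next a).start) {α : Γ₀} {V W : Γ₁}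
    (hV : α ∈ Γ.polygon V) (hW : α ∈ Γ.polygon W) : x V = x W := by
  obtain ⟨i, rfl⟩ := exists_seq_eq hV
  obtain ⟨j, rfl⟩ := exists_seq_eq hW
  -- A truncated vertex carries no arrows, but its only position makes the two polygons equal.
  by_cases ht : Γ.Truncated α
  · have hv : Γ.val α = 1 := Nat.eq_one_of_mul_eq_one_left ht
    have : Subsingleton (Fin (Γ.val α)) := by rw [hv]; infer_instance
    rw [Subsingleton.elim i j]
  · obtain ⟨k, hk⟩ := exists_next_iterate (a := (⟨⟨α, ht⟩, i⟩ : Γ.Arrow)) (b := ⟨⟨α, ht⟩, j⟩) rfl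
    change x (Arrow.start (⟨⟨α, ht⟩, i⟩ : Γ.Arrow)) = x (Arrow.start (⟨⟨α, ht⟩, j⟩ : Γ.Arrow))
    rw [← hk]
    clear hk
    induction k with
    | zero => rfl
    | succ k ih => rw [ih, Function.iterate_succ_apply', hx]

theorem IsBrauerTree.eq_of_next {X : Type*} (h : Γ.IsBrauerTree) (x : Γ.QVertex → X)
    (hx : ∀ a : Γ.Arrow, x a.start = x (Γ.next a).start) (V W : Γ.QVertex) : x V = x W := by
  have key : ∀ {α β : Γ₀}, Γ.adjGraph.Walk α β → ∀ V W : Γ₁, α ∈ Γ.polygon V →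
      β ∈ Γ.polygon W → x V = x W := by
    intro α β p
    induction p with
    | nil => exact fun V W => eq_of_mem_polygon hx
    | cons hadj p ih =>
      intro V W hV hW
      obtain ⟨-, U, hU⟩ := hadj
      exact (eq_of_mem_polygon hx (W := U) hV (by simp [hU])).trans
        (ih U W (by simp [hU]) hW)
  obtain ⟨α, hα, -⟩ := Γ.exists_nontruncated V
  obtain ⟨β, hβ, -⟩ := Γ.exists_nontruncated W
  obtain ⟨p⟩ := h.isTree.connected.preconnected α β
  exact key p V W hα hβ

theorem val_eq_one_iff_next_eq_self (a : Γ.Arrow) : Γ.next a = a ↔ Γ.val a.1.1 = 1 := by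
  rw [← Nat.dvd_one]
  exact next_iterate_eq_self_iff a 1

theorem IsBrauerTree.numLoops_eq (h : Γ.IsBrauerTree) : Γ.numLoops = Γ.setC.ncard := by
  rw [numLoops, ← Nat.card_coe_set_eq]
  -- The next arrow after a loop starts at the same polygon and belongs to the same vertex, so by
  -- `arrow_ext` it is the loop itself.
  have hval : ∀ {V : Γ.QVertex} (f : V ⟶ V), Γ.val f.1.1.1 = 1 := fun {V} f =>
    (val_eq_one_iff_next_eq_self f.1).1
      (h.arrow_ext _ _ (next_fst _) (f.2.2.trans f.2.1.symm))
  have hC : ∀ {V : Γ.QVertex} (f : V ⟶ V), f.1.1.1 ∈ Γ.setC := fun {V} f =>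
    ⟨hval f, by
      have h1 := f.1.two_le_fullLength
      rw [Arrow.fullLength, hval f] at h1
      omega⟩
  refine Nat.card_congr (Equiv.ofBijective
    (fun f : Σ V : Γ.QVertex, (V ⟶ V) => (⟨f.2.1.1.1, hC f.2⟩ : Γ.setC)) ⟨?_, ?_⟩)
  · rintro ⟨V, f⟩ ⟨W, g⟩ hfg
    have h1 : f.1.1 = g.1.1 := Subtype.ext (congrArg (Subtype.val : Γ.setC → Γ₀) hfg)
    have h2 : f.1 = g.1 := by
      obtain ⟨k, hk⟩ := exists_next_iterate h1
      rw [← hk]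
      exact ((next_iterate_eq_self_iff _ k).2 (by rw [hval f]; exact one_dvd k)).symm
    obtain ⟨a, ha, ha'⟩ := f
    obtain ⟨b, hb, hb'⟩ := g
    obtain rfl : a = b := h2
    obtain rfl : V = W := ha.symm.trans hb
    rfl
  · rintro ⟨α, hv, hμ⟩
    have ht : ¬ Γ.Truncated α := by
      rw [Truncated, hv]
      omega
    let a : Γ.Arrow := firstArrow ⟨α, ht⟩
    have ha : Γ.next a = a := (val_eq_one_iff_next_eq_self a).2 hv
    exact ⟨⟨a.start, ⟨a, rfl, congrArg Γ.source ha⟩⟩, rfl⟩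

end Tree

end BrauerConfiguration

theorem mainTheorem2 {K : Type*} [Field K] {Γ₀ Γ₁ : Type*} [Fintype Γ₀] [DecidableEq Γ₀]
    [Fintype Γ₁] (Γ : BrauerConfiguration Γ₀ Γ₁) (hTree : Γ.IsBrauerTree)
    (hLoop : ¬ Γ.IsSingleLoop) :
    Γ.numLoops = Γ.setC.ncard ∧
    Module.Finite K (Subalgebra.center K (Γ.brauerAlgebra K)) ∧
    (Module.finrank K (Subalgebra.center K (Γ.brauerAlgebra K)) : ℤ) =
      1 + ∑ α : Γ₀, (Γ.μ α : ℤ) + (Fintype.card Γ₁ : ℤ) - (Fintype.card Γ₀ : ℤ) := by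
  classical
  obtain ⟨α⟩ := hTree.isTree.connected.nonempty
  obtain ⟨V₀, -⟩ := Γ.exists_polygon α
  obtain ⟨e⟩ := BrauerConfiguration.nonempty_center_equiv K hTree.arrow_ext hTree.eq_of_next V₀
  refine ⟨hTree.numLoops_eq, Module.Finite.equiv e.symm, ?_⟩
  rw [e.finrank_eq, Module.finrank_fintype_fun_eq_card,
    BrauerConfiguration.card_centerIndex]
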